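/- Consider a sphere of radius $r>0$ rolling without slipping on a horizontal plane and driven by three internal rotors. Let $R\in SO(3)$ be its attitude, $\omega=\omega_s^s\in\mathbb R^3$ its body angular velocity and $\dot\Theta\in\mathbb R^3$ the vector of rotor velocities. Let $I^s=\mathrm{diag}(I_1,I_2,I_3)$ with $I_i>0$, $\mathbb J=\mathrm{diag}(J_a,J_a,J_a)$ with $J_a>0$, $m_T>0$ the total mass, $\hat x$ the matrix with $\hat x y=x\times y$, $\Gamma=R^Te_3$ and $M=M(\Gamma)=I^s+m_Tr^2\,\hat\Gamma^T\hat\Gamma$. The controlled rotational dynamics with rotor torque $u$ are $$\dot R=R\hat\omega,\qquad \dot\omega=M^{-1}\big((I^s\omega+\mathbb J\dot\Theta)\times\omega\big)-M^{-1}u,\qquad \mathbb J\dot\omega+\mathbb J\ddot\Theta=u .$$ Let $R_d\in SO(3)$ be a constant desired attitude (desired angular velocity $\omega_d^s=0$), let $K_p=\mathrm{diag}(\lambda_1,\lambda_2,\lambda_3)$ with $\lambda_i>0$, let $K_v>0$ be a scalar, let $V(R)=\mathrm{trace}\big(K_p(I_{3\times3}-R_d^TR)\big)$, and let $dV(R)\in\mathbb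 R^3$ be its differential in the left trivialization, $dV(R)\cdot\eta=\frac{d}{dt}\big|_{t=0}V(R\exp(t\hat\eta))$ for $\eta\in\mathbb R^3$. For a desired angular velocity $\omega_d^s$ and $R_e=R_d^TR$ the feedforward term is $$f_{FF}=M\Big(\tfrac12M^{-1}(\omega\times MR_e^T\omega_d^s)-\tfrac12M^{-1}(M\omega\times R_e^T\omega_d^s)\Big)+M(\omega\times R_e^T\omega_d^s)+MR_e^T\dot\omega_d^s .$$ Then $f_{FF}=0$ when $\omega_d^s=\dot\omega_d^s=0$, and under the feedback $u=dV(R)+K_v\omega$ the point $(R_d,0)\in SO(3)\times\mathbb R^3$ is locally asymptotically stable and, in fact, locally exponentially stable. Precisely, write $d(R,\omega)=\big(\|R-R_d\|_F^2+|\omega|^2\big)^{1/2}$, where $\|\cdot\|_F$ is the Frobenius norm. 1. (Stability.) For every $\varepsilon>0$ there is $\delta>0$ such that for every initial state with $d(R(0),\omega(0))<\delta$, and any initial $\dot\Theta(0)$, the closed-loop system has a solution on $[0,\infty)$, and every such solution satisfies $d(R(t),\omega(t))<\varepsilon$ for all $t\ge0$. 2. (Attractivity.) There is $\delta>0$ such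 that every solution on $[0,\infty)$ with $d(R(0),\omega(0))<\delta$, whatever $\dot\Theta(0)$, satisfies $(R(t),\omega(t))\to(R_d,0)$ as $t\to\infty$. 3. (Exponential stability.) There is $\delta>0$ such that for every $B$ there are $C,\alpha>0$ such that every solution on $[0,\infty)$ with $d(R(0),\omega(0))<\delta$ and $\max_i|\dot\theta_i(0)|\le B$ satisfies $d(R(t),\omega(t))\le C\,d(R(0),\omega(0))\,e^{-\alpha t}$ for all $t\ge0$. -/

import Mathlib

open Matrix

noncomputable section

namespace SphericalRobot

/-- Vectors of `ℝ³` (columns of coordinates). -/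
abbrev Vec : Type := Fin 3 → ℝ

/-- The rotation group `SO(3)`. -/
abbrev SO3 : Type := Matrix.specialOrthogonalGroup (Fin 3) ℝ

/-- The rotation matrix underlying an element of `SO(3)`. -/
abbrev SO3.mat (R : SO3) : Matrix (Fin 3) (Fin 3) ℝ := R

/-- The hat map `ℝ³ → 𝔰𝔬(3)`, with `hat x *ᵥ y = x ⨯₃ y`. -/
def hat (x : Vec) : Matrix (Fin 3) (Fin 3) ℝ :=
  !![0, -x 2, x 1; x 2, 0, -x 0; -x 1, x 0, 0]

theorem hat_mulVec (x y : Vec) : hat x *ᵥ y = x ⨯₃ y := by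
  ext i
  fin_cases i <;> simp [hat, cross_apply, Matrix.mulVec, dotProduct, Fin.sum_univ_three] <;> ring

/-- The unit vector `e₃`. -/
def e3 : Vec := Pi.single 2 1

/-- Physical parameters of the rolling sphere with three rotors. -/
structure Params where
  /-- the diagonal entries `I₁, I₂, I₃` of the inertia matrix `Iˢ` -/
  I : Fin 3 → ℝ
  /-- the axial moment of inertia `J_a` of each rotor -/
  Ja : ℝ
  /-- the total mass `m_T` -/
  mT : ℝ
  /-- the radius of the sphere -/
  r : ℝ
  I_pos : ∀ i, 0 < I i
  Ja_pos : 0 < Ja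
  mT_pos : 0 < mT
  r_pos : 0 < r

/-- `Iˢ = diag(I₁, I₂, I₃)`. -/
def Params.Imat (P : Params) : Matrix (Fin 3) (Fin 3) ℝ := Matrix.diagonal P.I

/-- `𝕁 = diag(J_a, J_a, J_a)`. -/
def Params.Jmat (P : Params) : Matrix (Fin 3) (Fin 3) ℝ := Matrix.diagonal fun _ => P.Ja

/-- The advected vector `Γ = Rᵀ e₃`. -/
def advected (R : SO3) : Vec := R.matᵀ *ᵥ e3

/-- The locked inertia matrix `M(Γ) = Iˢ + m_T r² Γ̂ᵀ Γ̂`, at `Γ = Rᵀ e₃`. -/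
def Params.M (P : Params) (R : SO3) : Matrix (Fin 3) (Fin 3) ℝ :=
  P.Imat + (P.mT * P.r ^ 2) • ((hat (advected R))ᵀ * hat (advected R))

/-- Right-hand side of the velocity equation of the control system `q̇ = f(q) + g(q) u`:
`M⁻¹ ((Iˢ ω + 𝕁 Θ̇) × ω) - M⁻¹ u`. The argument `ν` is the rotor velocity `Θ̇`. -/
def Params.omegaDot (P : Params) (R : SO3) (ω ν u : Vec) : Vec :=
  (P.M R)⁻¹ *ᵥ ((P.Imat *ᵥ ω + P.Jmat *ᵥ ν) ⨯₃ ω) - (P.M R)⁻¹ *ᵥ u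

/-- The rotor acceleration `Θ̈`, from `𝕁 ω̇ + 𝕁 Θ̈ = u`. -/
def Params.rotorDot (P : Params) (R : SO3) (ω ν u : Vec) : Vec :=
  P.Jmat⁻¹ *ᵥ u - P.omegaDot R ω ν u

/-- `(R, ω, ν)` is a trajectory on `[0, ∞)`, with `ν = Θ̇`, of the rotational dynamics of the robot
under the state feedback `u = k(R, ω)`. -/
structure IsTrajectory (P : Params) (k : SO3 → Vec → Vec) (R : ℝ → SO3) (ω ν : ℝ → Vec) :
    Prop where
  attitude : ∀ t, 0 ≤ t →
    HasDerivWithinAt (fun s => (R s).mat) ((R t).mat * hat (ω t)) (Set.Ici 0) t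
  velocity : ∀ t, 0 ≤ t →
    HasDerivWithinAt ω (P.omegaDot (R t) (ω t) (ν t) (k (R t) (ω t))) (Set.Ici 0) t
  rotor : ∀ t, 0 ≤ t →
    HasDerivWithinAt ν (P.rotorDot (R t) (ω t) (ν t) (k (R t) (ω t))) (Set.Ici 0) t

/-- The error function `V(A) = trace(K_p (1 - R_dᵀ A))`, with `K_p = diag(lam)`. -/
def errorFn (lam : Fin 3 → ℝ) (Rd : SO3) (A : Matrix (Fin 3) (Fin 3) ℝ) : ℝ :=
  Matrix.trace (Matrix.diagonal lam * (1 - Rd.matᵀ * A))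

/-- The differential `dV(R)` as a vector of `ℝ³`, through the left trivialization: its `i`-th
component is the derivative of `V` at `R` in the direction `R ê_i` tangent to `SO(3)`. -/
def dV (lam : Fin 3 → ℝ) (Rd R : SO3) : Vec := fun i =>
  deriv (fun t : ℝ =>
    errorFn lam Rd (R.mat * NormedSpace.exp (t • hat (Pi.single i 1)))) 0

/-- The feedforward term `f_FF`, where `ωd, ωd'` are the desired angular velocity and its time
derivative and `R_e = R_dᵀ R`. -/
def Params.feedforward (P : Params) (Rd R : SO3) (ω ωd ωd' : Vec) : Vec :=
  let M := P.M R
  let ReT := (Rd.matᵀ * R.mat)ᵀ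
  M *ᵥ ((1 / 2 : ℝ) • (M⁻¹ *ᵥ (ω ⨯₃ (M *ᵥ (ReT *ᵥ ωd))))
      - (1 / 2 : ℝ) • (M⁻¹ *ᵥ ((M *ᵥ ω) ⨯₃ (ReT *ᵥ ωd))))
    + M *ᵥ (ω ⨯₃ (ReT *ᵥ ωd)) + M *ᵥ (ReT *ᵥ ωd')

/-- The distance from `(R, ω)` to `(R_d, 0)` in `SO(3) × ℝ³`: the Frobenius distance for the
rotations and the Euclidean norm for the velocity. -/
def stateDist (Rd R : SO3) (ω : Vec) : ℝ :=
  Real.sqrt (Matrix.trace ((R.mat - Rd.mat)ᵀ * (R.mat - Rd.mat)) + ω ⬝ᵥ ω)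

/-- Lyapunov stability of `(R_d, 0)`: all initial states close to it have a trajectory
on `[0, ∞)`, and trajectories that start close to it stay close to it,
uniformly in the initial rotor velocity. -/
def IsLyapunovStable (P : Params) (k : SO3 → Vec → Vec) (Rd : SO3) : Prop :=
  ∀ ε > 0, ∃ δ > 0, ∀ (R₀ : SO3) (ω₀ ν₀ : Vec), stateDist Rd R₀ ω₀ < δ →
    (∃ R ω ν, IsTrajectory P k R ω ν ∧ R 0 = R₀ ∧ ω 0 = ω₀ ∧ ν 0 = ν₀) ∧
    ∀ R ω ν, IsTrajectory P k R ω ν → R 0 = R₀ → ω 0 = ω₀ → ν 0 = ν₀ →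
      ∀ t, 0 ≤ t → stateDist Rd (R t) (ω t) < ε

/-- Local attractivity of `(R_d, 0)`, in a neighbourhood that does not depend on the initial
rotor velocity. -/
def IsLocallyAttractive (P : Params) (k : SO3 → Vec → Vec) (Rd : SO3) : Prop :=
  ∃ δ > 0, ∀ R ω ν, IsTrajectory P k R ω ν → stateDist Rd (R 0) (ω 0) < δ →
    Filter.Tendsto R Filter.atTop (nhds Rd) ∧ Filter.Tendsto ω Filter.atTop (nhds 0)

/-- Local asymptotic stability: Lyapunov stability together with local attractivity. -/
def IsLocallyAsymptoticallyStable (P : Params) (k : SO3 → Vec → Vec) (Rd : SO3) : Prop :=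
  IsLyapunovStable P k Rd ∧ IsLocallyAttractive P k Rd

/-- Local exponential stability of `(R_d, 0)`: on a neighbourhood that does not depend on the
rotors, the distance to `(R_d, 0)` decays exponentially, with constants that are uniform for
initial rotor velocities in a bounded set. -/
def IsLocallyExponentiallyStable (P : Params) (k : SO3 → Vec → Vec) (Rd : SO3) : Prop :=
  IsLyapunovStable P k Rd ∧
  ∃ δ > 0, ∀ B : ℝ, ∃ C > 0, ∃ α > 0, ∀ R ω ν, IsTrajectory P k R ω ν →
    stateDist Rd (R 0) (ω 0) < δ → ‖ν 0‖ ≤ B →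
      ∀ t, 0 ≤ t →
        stateDist Rd (R t) (ω t) ≤ C * stateDist Rd (R 0) (ω 0) * Real.exp (-α * t)

section Differential

attribute [local instance] Matrix.linftyOpNormedAddCommGroup Matrix.linftyOpNormedSpace
  Matrix.linftyOpNormedRing Matrix.linftyOpNormedAlgebra

theorem hasDerivAt_errorFn_exp (lam : Fin 3 → ℝ) (Rd R : SO3) (η : Vec) :
    HasDerivAt (fun t : ℝ => errorFn lam Rd (R.mat * NormedSpace.exp (t • hat η)))
      (-Matrix.trace (Matrix.diagonal lam * (Rd.matᵀ * (R.mat * hat η)))) 0 := by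
  have h := hasDerivAt_exp_smul_const (𝕂 := ℝ) (hat η) (0 : ℝ)
  simp only [zero_smul, NormedSpace.exp_zero, one_mul] at h
  let L : Matrix (Fin 3) (Fin 3) ℝ →ₗ[ℝ] ℝ :=
    { toFun := fun A => Matrix.trace (Matrix.diagonal lam * (Rd.matᵀ * (R.mat * A)))
      map_add' := by intro A B; simp [mul_add]
      map_smul' := by intro c A; simp }
  have h2 := (LinearMap.toContinuousLinearMap L).hasFDerivAt.comp_hasDerivAt (0 : ℝ) h
  have h3 := (hasDerivAt_const (0 : ℝ) (Matrix.trace (Matrix.diagonal lam))).sub h2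
  refine (h3.congr_deriv ?_).congr_of_eventuallyEq (Filter.Eventually.of_forall ?_)
  · rw [zero_sub]
    rfl
  · intro t
    simp only [errorFn, mul_sub, mul_one, Matrix.trace_sub]
    rfl

end Differential

/-- Explicit form of the differential: `dV(R) = ∑ λᵢ (Rᵀ R_d eᵢ) × eᵢ`. -/
theorem dV_eq (lam : Fin 3 → ℝ) (Rd R : SO3) :
    dV lam Rd R = ∑ i, lam i • (((R.matᵀ * Rd.mat) *ᵥ Pi.single i 1) ⨯₃ Pi.single i 1) := by
  have hT : R.matᵀ * Rd.mat = (Rd.matᵀ * R.mat)ᵀ := by simp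
  ext j
  rw [dV, (hasDerivAt_errorFn_exp lam Rd R _).deriv, ← mul_assoc Rd.matᵀ, hT]
  generalize Rd.matᵀ * R.mat = A
  fin_cases j <;>
    simp [Matrix.trace, Fin.sum_univ_three, Matrix.mul_apply, hat, cross_apply,
      Matrix.diagonal_apply] <;> ring

end SphericalRobot

end

noncomputable section

namespace SphericalRobot

theorem dot_three (x y : Vec) : x ⬝ᵥ y = x 0 * y 0 + x 1 * y 1 + x 2 * y 2 := by
  simp [dotProduct, Fin.sum_univ_three]

theorem dot_self_nonneg (x : Vec) : 0 ≤ x ⬝ᵥ x := by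
  rw [dot_three]
  nlinarith [sq_nonneg (x 0), sq_nonneg (x 1), sq_nonneg (x 2)]

theorem sq_coord_le_dot_self (x : Vec) (i : Fin 3) : x i ^ 2 ≤ x ⬝ᵥ x := by
  rw [dot_three]
  fin_cases i <;> simp <;> nlinarith [sq_nonneg (x 0), sq_nonneg (x 1), sq_nonneg (x 2)]

theorem dot_self_add_le (x y : Vec) : (x + y) ⬝ᵥ (x + y) ≤ 2 * (x ⬝ᵥ x) + 2 * (y ⬝ᵥ y) := by
  have := dot_self_nonneg (x - y)
  simp only [dot_three, Pi.add_apply, Pi.sub_apply] at *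
  linarith

theorem two_mul_dot_le (x y : Vec) {a : ℝ} (ha : 0 < a) :
    2 * (x ⬝ᵥ y) ≤ a * (x ⬝ᵥ x) + a⁻¹ * (y ⬝ᵥ y) := by
  have h := dot_self_nonneg (a • x - y)
  have h2 : (a • x - y) ⬝ᵥ (a • x - y)
      = a * (a * (x ⬝ᵥ x) + a⁻¹ * (y ⬝ᵥ y) - 2 * (x ⬝ᵥ y)) := by
    simp only [dot_three, Pi.sub_apply, Pi.smul_apply, smul_eq_mul]
    field_simp
    ring
  rw [h2] at h
  linarith [nonneg_of_mul_nonneg_right h ha]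

theorem cross_dot_self (x y : Vec) :
    (x ⨯₃ y) ⬝ᵥ (x ⨯₃ y) = (x ⬝ᵥ x) * (y ⬝ᵥ y) - (x ⬝ᵥ y) ^ 2 := by
  simp only [dot_three, cross_apply]
  simp
  ring

/-- The inertia matrix `Iˢ + m_T r² Ĝᵀ Ĝ`, for an arbitrary vector `G`. -/
def Params.inertia (P : Params) (G : Vec) : Matrix (Fin 3) (Fin 3) ℝ :=
  P.Imat + (P.mT * P.r ^ 2) • ((hat G)ᵀ * hat G)

theorem Params.inertia_mulVec (P : Params) (G x : Vec) (i : Fin 3) :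
    (P.inertia G *ᵥ x) i
      = P.I i * x i + P.mT * P.r ^ 2 * ((G ⬝ᵥ G) * x i - (G ⬝ᵥ x) * G i) := by
  fin_cases i <;>
    simp [Params.inertia, Params.Imat, hat, Matrix.mulVec, Matrix.mul_apply, dotProduct,
      Fin.sum_univ_three, Matrix.diagonal_apply] <;> ring

theorem Params.dot_inertia_mulVec (P : Params) (G x : Vec) :
    x ⬝ᵥ (P.inertia G *ᵥ x) = P.I 0 * x 0 ^ 2 + P.I 1 * x 1 ^ 2 + P.I 2 * x 2 ^ 2
      + P.mT * P.r ^ 2 * ((G ⨯₃ x) ⬝ᵥ (G ⨯₃ x)) := by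
  rw [cross_dot_self]
  simp only [dot_three, P.inertia_mulVec]
  ring

theorem Params.mass_pos (P : Params) : 0 < P.mT * P.r ^ 2 :=
  mul_pos P.mT_pos (pow_pos P.r_pos 2)

theorem Params.exists_le_dot_inertia (P : Params) :
    ∃ a > 0, ∀ G x : Vec, a * (x ⬝ᵥ x) ≤ x ⬝ᵥ (P.inertia G *ᵥ x) := by
  obtain ⟨i, hi⟩ := Finite.exists_min P.I
  refine ⟨P.I i, P.I_pos i, fun G x => ?_⟩
  rw [P.dot_inertia_mulVec, dot_three]
  have h0 := mul_nonneg P.mass_pos.le (dot_self_nonneg (G ⨯₃ x))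
  have h1 := mul_le_mul_of_nonneg_right (hi 0) (sq_nonneg (x 0))
  have h2 := mul_le_mul_of_nonneg_right (hi 1) (sq_nonneg (x 1))
  have h3 := mul_le_mul_of_nonneg_right (hi 2) (sq_nonneg (x 2))
  linarith

theorem Params.isUnit_inertia (P : Params) (G : Vec) : IsUnit (P.inertia G) := by
  rw [← Matrix.mulVec_injective_iff_isUnit]
  obtain ⟨a, ha, h⟩ := P.exists_le_dot_inertia
  refine (injective_iff_map_eq_zero (P.inertia G).mulVecLin).2 fun x hx => ?_
  have h1 := h G x
  have h2 : P.inertia G *ᵥ x = 0 := hx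
  rw [h2, dotProduct_zero] at h1
  have h3 : x ⬝ᵥ x = 0 := le_antisymm (nonpos_of_mul_nonpos_right h1 ha) (dot_self_nonneg x)
  exact dotProduct_self_eq_zero.1 h3

theorem Params.isUnit_det_inertia (P : Params) (G : Vec) : IsUnit (P.inertia G).det :=
  (Matrix.isUnit_iff_isUnit_det _).1 (P.isUnit_inertia G)

theorem Params.M_eq_inertia (P : Params) (R : SO3) : P.M R = P.inertia (advected R) := rfl

theorem SO3.mul_transpose (R : SO3) : R.mat * R.matᵀ = 1 :=
  (Matrix.mem_orthogonalGroup_iff (Fin 3) ℝ).1 (Matrix.mem_specialOrthogonalGroup_iff.1 R.2).1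

theorem SO3.transpose_mul (R : SO3) : R.matᵀ * R.mat = 1 :=
  (Matrix.mem_orthogonalGroup_iff' (Fin 3) ℝ).1 (Matrix.mem_specialOrthogonalGroup_iff.1 R.2).1

theorem SO3.det_mat (R : SO3) : R.mat.det = 1 := (Matrix.mem_specialOrthogonalGroup_iff.1 R.2).2

theorem SO3.adjugate_mat (R : SO3) : R.mat.adjugate = R.matᵀ := by
  have h := Matrix.mul_adjugate R.mat
  rw [R.det_mat, one_smul] at h
  calc R.mat.adjugate = (R.matᵀ * R.mat) * R.mat.adjugate := by rw [R.transpose_mul, one_mul]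
    _ = R.matᵀ := by rw [mul_assoc, h, mul_one]

theorem advected_apply (R : SO3) (i : Fin 3) : advected R i = R.mat 2 i := by
  simp [advected, e3]

theorem SO3.row_dot (R : SO3) (i : Fin 3) :
    R.mat i 0 ^ 2 + R.mat i 1 ^ 2 + R.mat i 2 ^ 2 = 1 := by
  have h := congr_fun₂ R.mul_transpose i i
  simp only [Matrix.mul_apply, Fin.sum_univ_three, Matrix.transpose_apply,
    Matrix.one_apply_eq] at h
  linarith

theorem SO3.col_dot (R : SO3) (i : Fin 3) :
    R.mat 0 i ^ 2 + R.mat 1 i ^ 2 + R.mat 2 i ^ 2 = 1 := by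
  have h := congr_fun₂ R.transpose_mul i i
  simp only [Matrix.mul_apply, Fin.sum_univ_three, Matrix.transpose_apply,
    Matrix.one_apply_eq] at h
  linarith

theorem advected_dot_self (R : SO3) : advected R ⬝ᵥ advected R = 1 := by
  rw [dot_three]
  simp only [advected_apply]
  linarith [R.row_dot 2]

theorem Params.M_mulVec (P : Params) (R : SO3) (x : Vec) (i : Fin 3) :
    (P.M R *ᵥ x) i
      = P.I i * x i + P.mT * P.r ^ 2 * (x i - (advected R ⬝ᵥ x) * advected R i) := by
  rw [P.M_eq_inertia, P.inertia_mulVec, advected_dot_self, one_mul]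

theorem Params.M_mulVec_omegaDot (P : Params) (R : SO3) (ω ν u : Vec) :
    P.M R *ᵥ P.omegaDot R ω ν u = (P.Imat *ᵥ ω + P.Jmat *ᵥ ν) ⨯₃ ω - u := by
  have h : P.M R * (P.M R)⁻¹ = 1 := Matrix.mul_nonsing_inv _ (P.isUnit_det_inertia (advected R))
  rw [Params.omegaDot, Matrix.mulVec_sub, Matrix.mulVec_mulVec, Matrix.mulVec_mulVec, h,
    Matrix.one_mulVec, Matrix.one_mulVec]

theorem Params.Imat_mulVec (P : Params) (x : Vec) (i : Fin 3) :
    (P.Imat *ᵥ x) i = P.I i * x i := Matrix.mulVec_diagonal _ _ _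

theorem Params.Jmat_mulVec (P : Params) (x : Vec) : P.Jmat *ᵥ x = P.Ja • x := by
  ext i
  exact Matrix.mulVec_diagonal _ _ _

theorem Params.Jmat_inv_mulVec (P : Params) (x : Vec) : P.Jmat⁻¹ *ᵥ x = P.Ja⁻¹ • x := by
  have h : P.Jmat * Matrix.diagonal (fun _ => P.Ja⁻¹) = 1 := by
    rw [Params.Jmat, Matrix.diagonal_mul_diagonal]
    simp [P.Ja_pos.ne']
  rw [Matrix.inv_eq_right_inv h]
  ext i
  exact Matrix.mulVec_diagonal _ _ _

theorem Params.exists_M_mulVec_le (P : Params) :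
    ∃ K > 0, ∀ (R : SO3) (x : Vec), (P.M R *ᵥ x) ⬝ᵥ (P.M R *ᵥ x) ≤ K * (x ⬝ᵥ x) := by
  refine ⟨2 * (P.I 0 ^ 2 + P.I 1 ^ 2 + P.I 2 ^ 2) + 2 * (P.mT * P.r ^ 2) ^ 2, ?_,
    fun R x => ?_⟩
  · have := P.mass_pos
    positivity
  have h1 : P.M R *ᵥ x = P.Imat *ᵥ x
      + (P.mT * P.r ^ 2) • (x - (advected R ⬝ᵥ x) • advected R) := by
    ext i
    rw [P.M_mulVec, Pi.add_apply, P.Imat_mulVec]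
    rfl
  rw [h1]
  refine (dot_self_add_le _ _).trans ?_
  have h2 : (P.Imat *ᵥ x) ⬝ᵥ (P.Imat *ᵥ x)
      ≤ (P.I 0 ^ 2 + P.I 1 ^ 2 + P.I 2 ^ 2) * (x ⬝ᵥ x) := by
    simp only [dot_three, P.Imat_mulVec]
    nlinarith [mul_nonneg (sq_nonneg (P.I 0)) (sq_nonneg (x 1)),
      mul_nonneg (sq_nonneg (P.I 0)) (sq_nonneg (x 2)),
      mul_nonneg (sq_nonneg (P.I 1)) (sq_nonneg (x 0)),
      mul_nonneg (sq_nonneg (P.I 1)) (sq_nonneg (x 2)),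
      mul_nonneg (sq_nonneg (P.I 2)) (sq_nonneg (x 0)),
      mul_nonneg (sq_nonneg (P.I 2)) (sq_nonneg (x 1))]
  have h3 : ((P.mT * P.r ^ 2) • (x - (advected R ⬝ᵥ x) • advected R)) ⬝ᵥ
      ((P.mT * P.r ^ 2) • (x - (advected R ⬝ᵥ x) • advected R))
      = (P.mT * P.r ^ 2) ^ 2 * ((x ⬝ᵥ x) - (advected R ⬝ᵥ x) ^ 2) := by
    have := advected_dot_self R
    simp only [smul_dotProduct, dotProduct_smul, sub_dotProduct, dotProduct_sub, smul_eq_mul, this,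
      dotProduct_comm x (advected R)]
    ring
  rw [h3]
  nlinarith [mul_nonneg (sq_nonneg (P.mT * P.r ^ 2)) (sq_nonneg (advected R ⬝ᵥ x))]

/-- The relative attitude `R_e = R_dᵀ R`. -/
def relAtt (Rd R : SO3) : SO3 := Rd⁻¹ * R

theorem relAtt_mat (Rd R : SO3) : (relAtt Rd R).mat = Rd.matᵀ * R.mat := rfl

/-- Half of the vector of the skew part of a matrix; for a rotation, `sin θ` times the axis. -/
def axial (Q : Matrix (Fin 3) (Fin 3) ℝ) : Vec :=
  ![(Q 2 1 - Q 1 2) / 2, (Q 0 2 - Q 2 0) / 2, (Q 1 0 - Q 0 1) / 2]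

/-- The gap `3 - trace Q = 2 (1 - cos θ)`. -/
def traceGap (Q : Matrix (Fin 3) (Fin 3) ℝ) : ℝ := 3 - (Q 0 0 + Q 1 1 + Q 2 2)

/-- The differential of `V` as a function of the relative attitude. -/
def gradV (lam : Fin 3 → ℝ) (Q : Matrix (Fin 3) (Fin 3) ℝ) : Vec :=
  ![lam 2 * Q 2 1 - lam 1 * Q 1 2, lam 0 * Q 0 2 - lam 2 * Q 2 0, lam 1 * Q 1 0 - lam 0 * Q 0 1]

/-- The potential `∑ λᵢ (1 - Qᵢᵢ)` as a function of the relative attitude. -/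
def potential (lam : Fin 3 → ℝ) (Q : Matrix (Fin 3) (Fin 3) ℝ) : ℝ :=
  lam 0 * (1 - Q 0 0) + lam 1 * (1 - Q 1 1) + lam 2 * (1 - Q 2 2)

theorem dV_eq_gradV (lam : Fin 3 → ℝ) (Rd R : SO3) :
    dV lam Rd R = gradV lam (relAtt Rd R).mat := by
  have hT : R.matᵀ * Rd.mat = (relAtt Rd R).matᵀ := by simp [relAtt_mat]
  rw [dV_eq, hT]
  ext i
  fin_cases i <;> simp [gradV, Fin.sum_univ_three, cross_apply] <;> ring

theorem SO3.apply_diag_le (Q : SO3) (i : Fin 3) : Q.mat i i ≤ 1 := by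
  have h := Q.row_dot i
  have : Q.mat i i ^ 2 ≤ 1 := by
    fin_cases i <;> simp only [Fin.zero_eta, Fin.mk_one, Fin.reduceFinMk] at h ⊢ <;>
    nlinarith [sq_nonneg (Q.mat 0 0), sq_nonneg (Q.mat 0 1), sq_nonneg (Q.mat 0 2),
      sq_nonneg (Q.mat 1 0), sq_nonneg (Q.mat 1 1), sq_nonneg (Q.mat 1 2),
      sq_nonneg (Q.mat 2 0), sq_nonneg (Q.mat 2 1), sq_nonneg (Q.mat 2 2)]
  nlinarith

theorem traceGap_nonneg (Q : SO3) : 0 ≤ traceGap Q.mat := by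
  have h0 := Q.apply_diag_le 0
  have h1 := Q.apply_diag_le 1
  have h2 := Q.apply_diag_le 2
  unfold traceGap
  linarith

theorem axial_dot_self (Q : SO3) :
    axial Q.mat ⬝ᵥ axial Q.mat = traceGap Q.mat * (4 - traceGap Q.mat) / 4 := by
  have h := Q.adjugate_mat
  rw [Matrix.adjugate_fin_three] at h
  have h0 := congr_fun₂ h 0 0
  have h1 := congr_fun₂ h 1 1
  have h2 := congr_fun₂ h 2 2
  have r0 := Q.row_dot 0
  have r1 := Q.row_dot 1
  have r2 := Q.row_dot 2
  simp at h0 h1 h2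
  simp only [dot_three, axial, traceGap]
  simp
  linear_combination (r0 + r1 + r2) / 4 + (h0 + h1 + h2) / 2

theorem axial_dot_gradV (lam : Fin 3 → ℝ) (Q : SO3) :
    axial Q.mat ⬝ᵥ gradV lam Q.mat = (lam 1 + lam 2) * axial Q.mat 0 ^ 2
      + (lam 2 + lam 0) * axial Q.mat 1 ^ 2 + (lam 0 + lam 1) * axial Q.mat 2 ^ 2 := by
  have r0 := Q.row_dot 0
  have r1 := Q.row_dot 1
  have r2 := Q.row_dot 2
  have c0 := Q.col_dot 0
  have c1 := Q.col_dot 1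
  have c2 := Q.col_dot 2
  simp only [dot_three, axial, gradV]
  simp
  linear_combination (lam 0 * (r0 - c0) + lam 1 * (r1 - c1) + lam 2 * (r2 - c2)) / 4

theorem le_axial_dot_gradV {lam : Fin 3 → ℝ} {l : ℝ} (hl : ∀ i, l ≤ lam i) (Q : SO3) :
    2 * l * (axial Q.mat ⬝ᵥ axial Q.mat) ≤ axial Q.mat ⬝ᵥ gradV lam Q.mat := by
  rw [axial_dot_gradV, dot_three]
  nlinarith [mul_le_mul_of_nonneg_right (add_le_add (hl 1) (hl 2)) (sq_nonneg (axial Q.mat 0)),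
    mul_le_mul_of_nonneg_right (add_le_add (hl 2) (hl 0)) (sq_nonneg (axial Q.mat 1)),
    mul_le_mul_of_nonneg_right (add_le_add (hl 0) (hl 1)) (sq_nonneg (axial Q.mat 2))]

theorem le_potential {lam : Fin 3 → ℝ} {l : ℝ} (hl : ∀ i, l ≤ lam i) (Q : SO3) :
    l * traceGap Q.mat ≤ potential lam Q.mat := by
  have h (i) := mul_le_mul_of_nonneg_right (hl i) (sub_nonneg.2 (Q.apply_diag_le i))
  unfold traceGap potential
  linarith [h 0, h 1, h 2]

theorem potential_le {lam : Fin 3 → ℝ} {l : ℝ} (hl : ∀ i, lam i ≤ l) (Q : SO3) :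
    potential lam Q.mat ≤ l * traceGap Q.mat := by
  have h (i) := mul_le_mul_of_nonneg_right (hl i) (sub_nonneg.2 (Q.apply_diag_le i))
  unfold traceGap potential
  linarith [h 0, h 1, h 2]

theorem stateDist_eq (Rd R : SO3) (ω : Vec) :
    stateDist Rd R ω = Real.sqrt (2 * traceGap (relAtt Rd R).mat + ω ⬝ᵥ ω) := by
  rw [stateDist]
  congr 2
  have h1 : (R.mat - Rd.mat)ᵀ * (R.mat - Rd.mat)
      = (1 + 1) - Rd.matᵀ * R.mat - (Rd.matᵀ * R.mat)ᵀ := by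
    rw [Matrix.transpose_sub, sub_mul, mul_sub, mul_sub, R.transpose_mul, Rd.transpose_mul,
      Matrix.transpose_mul, Matrix.transpose_transpose]
    abel
  rw [h1, relAtt_mat, Matrix.trace_sub, Matrix.trace_sub, Matrix.trace_transpose]
  simp [traceGap, Matrix.trace, Fin.sum_univ_three]
  ring

theorem stateDist_nonneg (Rd R : SO3) (ω : Vec) : 0 ≤ stateDist Rd R ω := Real.sqrt_nonneg _

theorem stateDist_sq (Rd R : SO3) (ω : Vec) :
    stateDist Rd R ω ^ 2 = 2 * traceGap (relAtt Rd R).mat + ω ⬝ᵥ ω := by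
  rw [stateDist_eq, Real.sq_sqrt]
  linarith [traceGap_nonneg (relAtt Rd R), dot_self_nonneg ω]

theorem le_mul_exp_of_hasDerivWithinAt {f f' : ℝ → ℝ} {a : ℝ}
    (hf : ∀ t, 0 ≤ t → HasDerivWithinAt f (f' t) (Set.Ici 0) t)
    (hle : ∀ t, 0 ≤ t → f' t ≤ -a * f t) {t : ℝ} (ht : 0 ≤ t) :
    f t ≤ f 0 * Real.exp (-a * t) := by
  have hg (s : ℝ) (hs : 0 ≤ s) : HasDerivWithinAt (fun s => f s * Real.exp (a * s))
      (f' s * Real.exp (a * s) + f s * (Real.exp (a * s) * a)) (Set.Ici 0) s := by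
    have h := (((hasDerivAt_id s).const_mul a).exp).hasDerivWithinAt (s := Set.Ici 0)
    simp only [id, mul_one] at h
    exact (hf s hs).mul h
  have hanti : AntitoneOn (fun s => f s * Real.exp (a * s)) (Set.Ici 0) := by
    refine antitoneOn_of_hasDerivWithinAt_nonpos (convex_Ici 0)
      (fun s hs => (hg s hs).continuousWithinAt)
      (fun s hs => (hg s (interior_subset hs)).mono interior_subset) fun s hs => ?_
    have h1 := hle s (interior_subset hs)
    have h2 := Real.exp_pos (a * s)
    nlinarith
  have h := hanti Set.self_mem_Ici ht ht
  simp only [mul_zero, Real.exp_zero, mul_one] at h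
  calc f t = f t * Real.exp (a * t) * Real.exp (-a * t) := by
        rw [mul_assoc, ← Real.exp_add]
        simp
    _ ≤ f 0 * Real.exp (-a * t) := mul_le_mul_of_nonneg_right h (Real.exp_pos _).le

/-- A trajectory of the closed-loop vector field multiplied by the scalar function `c`. -/
structure IsScaledTrajectory (P : Params) (k : SO3 → Vec → Vec) (c : ℝ → ℝ) (R : ℝ → SO3)
    (ω ν : ℝ → Vec) : Prop where
  attitude : ∀ t, 0 ≤ t → ∀ i j,
    HasDerivWithinAt (fun s => (R s).mat i j) (c t * ((R t).mat * hat (ω t)) i j) (Set.Ici 0) t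
  velocity : ∀ t, 0 ≤ t → ∀ i,
    HasDerivWithinAt (fun s => ω s i)
      (c t * P.omegaDot (R t) (ω t) (ν t) (k (R t) (ω t)) i) (Set.Ici 0) t
  rotor : ∀ t, 0 ≤ t → ∀ i,
    HasDerivWithinAt (fun s => ν s i)
      (c t * P.rotorDot (R t) (ω t) (ν t) (k (R t) (ω t)) i) (Set.Ici 0) t

theorem isTrajectory_iff_isScaledTrajectory_one {P : Params} {k : SO3 → Vec → Vec} {R : ℝ → SO3}
    {ω ν : ℝ → Vec} :
    IsTrajectory P k R ω ν ↔ IsScaledTrajectory P k (fun _ => 1) R ω ν := by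
  have hmat {t : ℝ} {A' : Matrix (Fin 3) (Fin 3) ℝ} :
      HasDerivWithinAt (fun s => (R s).mat) A' (Set.Ici 0) t
        ↔ ∀ i j, HasDerivWithinAt (fun s => (R s).mat i j) (A' i j) (Set.Ici 0) t :=
    (hasDerivWithinAt_pi (φ := fun s i => (R s).mat i) (φ' := A')).trans
      (forall_congr' fun _ => hasDerivWithinAt_pi)
  constructor
  · rintro ⟨h1, h2, h3⟩
    refine ⟨fun t ht => ?_, fun t ht => ?_, fun t ht => ?_⟩ <;> simp only [one_mul]
    · exact hmat.1 (h1 t ht)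
    · exact hasDerivWithinAt_pi.1 (h2 t ht)
    · exact hasDerivWithinAt_pi.1 (h3 t ht)
  · rintro ⟨h1, h2, h3⟩
    simp only [one_mul] at h1 h2 h3
    exact ⟨fun t ht => hmat.2 (h1 t ht), fun t ht => hasDerivWithinAt_pi.2 (h2 t ht),
      fun t ht => hasDerivWithinAt_pi.2 (h3 t ht)⟩

/-- The total angular momentum `M ω + 𝕁 (ω + Θ̇)` in body coordinates. -/
def Params.momentum (P : Params) (R : SO3) (ω ν : Vec) : Vec := P.M R *ᵥ ω + P.Ja • (ω + ν)

/-- The closed-loop energy `V(R) + ½ ω ⬝ M ω`. -/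
def Params.energy (P : Params) (lam : Fin 3 → ℝ) (Rd R : SO3) (ω : Vec) : ℝ :=
  potential lam (relAtt Rd R).mat + (ω ⬝ᵥ (P.M R *ᵥ ω)) / 2

theorem hasDerivWithinAt_dot {x y : ℝ → Vec} {x' y' : Vec} {s : Set ℝ} {t : ℝ}
    (hx : ∀ i, HasDerivWithinAt (fun s => x s i) (x' i) s t)
    (hy : ∀ i, HasDerivWithinAt (fun s => y s i) (y' i) s t) :
    HasDerivWithinAt (fun s => x s ⬝ᵥ y s) (x' ⬝ᵥ y t + x t ⬝ᵥ y') s t := by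
  have h := (((hx 0).mul (hy 0)).add ((hx 1).mul (hy 1))).add ((hx 2).mul (hy 2))
  refine (h.congr_deriv ?_).congr (fun s _ => ?_) ?_
  · simp only [dot_three]
    ring
  · rw [dot_three]; rfl
  · rw [dot_three]; rfl

theorem Params.dot_M_mulVec_comm (P : Params) (R : SO3) (x y : Vec) :
    x ⬝ᵥ (P.M R *ᵥ y) = (P.M R *ᵥ x) ⬝ᵥ y := by
  simp only [dot_three, P.M_mulVec]
  ring

namespace IsScaledTrajectory

variable {P : Params} {k : SO3 → Vec → Vec} {c : ℝ → ℝ} {R : ℝ → SO3} {ω ν : ℝ → Vec}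

theorem hasDerivWithinAt_advected (h : IsScaledTrajectory P k c R ω ν) {t : ℝ} (ht : 0 ≤ t)
    (i : Fin 3) : HasDerivWithinAt (fun s => advected (R s) i)
      (c t * (advected (R t) ⨯₃ ω t) i) (Set.Ici 0) t := by
  have h1 := h.attitude t ht 2 i
  simp only [advected_apply]
  refine h1.congr_deriv ?_
  congr 1
  simp only [cross_apply, advected_apply]
  fin_cases i <;> simp [Matrix.mul_apply, Fin.sum_univ_three, hat] <;> ring

theorem hasDerivWithinAt_relAtt (h : IsScaledTrajectory P k c R ω ν) (Rd : SO3) {t : ℝ}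
    (ht : 0 ≤ t) (i j : Fin 3) : HasDerivWithinAt (fun s => (relAtt Rd (R s)).mat i j)
      (c t * ((relAtt Rd (R t)).mat * hat (ω t)) i j) (Set.Ici 0) t := by
  have h1 := (((h.attitude t ht 0 j).const_mul (Rd.mat 0 i)).add
    ((h.attitude t ht 1 j).const_mul (Rd.mat 1 i))).add
    ((h.attitude t ht 2 j).const_mul (Rd.mat 2 i))
  have hE (A : Matrix (Fin 3) (Fin 3) ℝ) : (Rd.matᵀ * A) i j
      = Rd.mat 0 i * A 0 j + Rd.mat 1 i * A 1 j + Rd.mat 2 i * A 2 j := by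
    simp [Matrix.mul_apply, Fin.sum_univ_three]
  refine (h1.congr_deriv ?_).congr (fun s _ => ?_) ?_
  · rw [relAtt_mat, mul_assoc, hE]
    ring
  · rw [relAtt_mat, hE]; rfl
  · rw [relAtt_mat, hE]; rfl

theorem hasDerivWithinAt_potential (h : IsScaledTrajectory P k c R ω ν) (lam : Fin 3 → ℝ)
    (Rd : SO3) {t : ℝ} (ht : 0 ≤ t) :
    HasDerivWithinAt (fun s => potential lam (relAtt Rd (R s)).mat)
      (c t * (dV lam Rd (R t) ⬝ᵥ ω t)) (Set.Ici 0) t := by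
  have h1 (i) := ((h.hasDerivWithinAt_relAtt Rd ht i i).const_sub 1).const_mul (lam i)
  refine (((h1 0).add (h1 1)).add (h1 2)).congr_deriv ?_
  rw [dV_eq_gradV, dot_three]
  simp [gradV, Matrix.mul_apply, Fin.sum_univ_three, hat]
  ring

theorem hasDerivWithinAt_axial (h : IsScaledTrajectory P k c R ω ν) (Rd : SO3) {t : ℝ}
    (ht : 0 ≤ t) (i : Fin 3) : HasDerivWithinAt (fun s => axial (relAtt Rd (R s)).mat i)
      (c t * (((3 - traceGap (relAtt Rd (R t)).mat) * ω t i
        - ((relAtt Rd (R t)).matᵀ *ᵥ ω t) i) / 2)) (Set.Ici 0) t := by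
  have h1 := h.hasDerivWithinAt_relAtt Rd ht
  fin_cases i
  · refine (((h1 2 1).sub (h1 1 2)).div_const 2).congr_deriv ?_
    simp [traceGap, Matrix.mul_apply, Matrix.mulVec, dotProduct, Fin.sum_univ_three, hat]
    ring
  · refine (((h1 0 2).sub (h1 2 0)).div_const 2).congr_deriv ?_
    simp [traceGap, Matrix.mul_apply, Matrix.mulVec, dotProduct, Fin.sum_univ_three, hat]
    ring
  · refine (((h1 1 0).sub (h1 0 1)).div_const 2).congr_deriv ?_
    simp [traceGap, Matrix.mul_apply, Matrix.mulVec, dotProduct, Fin.sum_univ_three, hat]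
    ring

theorem hasDerivWithinAt_M_mulVec (h : IsScaledTrajectory P k c R ω ν) {t : ℝ} (ht : 0 ≤ t)
    (i : Fin 3) : HasDerivWithinAt (fun s => (P.M (R s) *ᵥ ω s) i)
      (c t * ((P.momentum (R t) (ω t) (ν t) ⨯₃ ω t) i - k (R t) (ω t) i)) (Set.Ici 0) t := by
  set w := P.omegaDot (R t) (ω t) (ν t) (k (R t) (ω t)) with hw
  have hG := h.hasDerivWithinAt_advected ht
  have hω := h.velocity t ht
  have hdot := hasDerivWithinAt_dot (x' := c t • (advected (R t) ⨯₃ ω t)) (y' := c t • w) hG hω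
  have h1 := ((hω i).const_mul (P.I i)).add
    (((hω i).sub (hdot.mul (hG i))).const_mul (P.mT * P.r ^ 2))
  simp only [P.M_mulVec]
  refine h1.congr_deriv ?_
  have h2 := congr_fun (P.M_mulVec_omegaDot (R t) (ω t) (ν t) (k (R t) (ω t))) i
  rw [← hw, P.M_mulVec, P.Jmat_mulVec] at h2
  have h3 : (advected (R t) ⨯₃ ω t) ⬝ᵥ ω t = 0 := by
    rw [dotProduct_comm, dot_cross_self]
  have h4 : (P.momentum (R t) (ω t) (ν t) ⨯₃ ω t) i
      = ((P.Imat *ᵥ ω t + P.Ja • ν t) ⨯₃ ω t) i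
        - P.mT * P.r ^ 2 * (advected (R t) ⬝ᵥ ω t) * (advected (R t) ⨯₃ ω t) i := by
    simp only [cross_apply, Params.momentum, Pi.add_apply, P.M_mulVec, P.Imat_mulVec,
      Pi.smul_apply, smul_eq_mul]
    fin_cases i <;> simp <;> ring
  rw [h4]
  simp only [Pi.sub_apply] at h2
  simp only [smul_dotProduct, dotProduct_smul, h3, smul_eq_mul]
  linear_combination c t * h2

theorem hasDerivWithinAt_momentum (h : IsScaledTrajectory P k c R ω ν) {t : ℝ} (ht : 0 ≤ t)
    (i : Fin 3) : HasDerivWithinAt (fun s => P.momentum (R s) (ω s) (ν s) i)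
      (c t * (P.momentum (R t) (ω t) (ν t) ⨯₃ ω t) i) (Set.Ici 0) t := by
  have h1 := (h.hasDerivWithinAt_M_mulVec ht i).add
    (((h.velocity t ht i).add (h.rotor t ht i)).const_mul P.Ja)
  refine h1.congr_deriv ?_
  rw [Params.rotorDot, P.Jmat_inv_mulVec]
  have := P.Ja_pos.ne'
  simp only [Pi.sub_apply, Pi.smul_apply, smul_eq_mul]
  field_simp
  ring

theorem hasDerivWithinAt_energy {lam : Fin 3 → ℝ} {Rd : SO3} {Kv : ℝ}
    (h : IsScaledTrajectory P (fun R ω => dV lam Rd R + Kv • ω) c R ω ν) {t : ℝ} (ht : 0 ≤ t) :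
    HasDerivWithinAt (fun s => P.energy lam Rd (R s) (ω s))
      (-(c t * (Kv * (ω t ⬝ᵥ ω t)))) (Set.Ici 0) t := by
  set u := dV lam Rd (R t) + Kv • ω t with hu
  set w := P.omegaDot (R t) (ω t) (ν t) u with hw
  have hdot := hasDerivWithinAt_dot (x' := c t • w)
    (y' := c t • (P.momentum (R t) (ω t) (ν t) ⨯₃ ω t - u))
    (h.velocity t ht) (h.hasDerivWithinAt_M_mulVec ht)
  refine ((h.hasDerivWithinAt_potential lam Rd ht).add (hdot.div_const 2)).congr_deriv ?_
  have h1 : w ⬝ᵥ (P.M (R t) *ᵥ ω t) = -(u ⬝ᵥ ω t) := by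
    rw [P.dot_M_mulVec_comm, hw, P.M_mulVec_omegaDot, sub_dotProduct, dotProduct_comm (_ ⨯₃ _),
      dot_cross_self, zero_sub]
  rw [smul_dotProduct, h1, dotProduct_smul, dotProduct_sub, dot_cross_self,
    dotProduct_comm (ω t) u, hu, add_dotProduct, smul_dotProduct]
  simp only [smul_eq_mul]
  ring

theorem momentum_dot_self_le (h : IsScaledTrajectory P k c R ω ν) {t : ℝ} (ht : 0 ≤ t) :
    P.momentum (R t) (ω t) (ν t) ⬝ᵥ P.momentum (R t) (ω t) (ν t)
      ≤ P.momentum (R 0) (ω 0) (ν 0) ⬝ᵥ P.momentum (R 0) (ω 0) (ν 0) := by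
  have h1 (t : ℝ) (ht : 0 ≤ t) := hasDerivWithinAt_dot
    (x' := c t • (P.momentum (R t) (ω t) (ν t) ⨯₃ ω t))
    (y' := c t • (P.momentum (R t) (ω t) (ν t) ⨯₃ ω t))
    (h.hasDerivWithinAt_momentum ht) (h.hasDerivWithinAt_momentum ht)
  have h2 := le_mul_exp_of_hasDerivWithinAt (a := 0) h1 (fun t _ => ?_) ht
  · simpa using h2
  · rw [smul_dotProduct, dotProduct_smul, dot_self_cross, dotProduct_comm (_ ⨯₃ _),
      dot_self_cross]
    simp

theorem energy_le {lam : Fin 3 → ℝ} {Rd : SO3} {Kv : ℝ} (hKv : 0 ≤ Kv) (hc : ∀ t, 0 ≤ c t)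
    (h : IsScaledTrajectory P (fun R ω => dV lam Rd R + Kv • ω) c R ω ν) {t : ℝ} (ht : 0 ≤ t) :
    P.energy lam Rd (R t) (ω t) ≤ P.energy lam Rd (R 0) (ω 0) := by
  have h2 := le_mul_exp_of_hasDerivWithinAt (a := 0) (fun t ht => h.hasDerivWithinAt_energy ht)
    (fun t _ => ?_) ht
  · simpa using h2
  · have := mul_nonneg (hc t) (mul_nonneg hKv (dot_self_nonneg (ω t)))
    linarith

end IsScaledTrajectory

theorem traceGap_le_stateDist_sq (Rd R : SO3) (ω : Vec) :
    traceGap (relAtt Rd R).mat ≤ stateDist Rd R ω ^ 2 := by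
  rw [stateDist_sq]
  linarith [traceGap_nonneg (relAtt Rd R), dot_self_nonneg ω]

theorem dot_self_le_stateDist_sq (Rd R : SO3) (ω : Vec) : ω ⬝ᵥ ω ≤ stateDist Rd R ω ^ 2 := by
  rw [stateDist_sq]
  linarith [traceGap_nonneg (relAtt Rd R)]

theorem axial_dot_self_le (Q : SO3) : axial Q.mat ⬝ᵥ axial Q.mat ≤ traceGap Q.mat := by
  rw [axial_dot_self]
  nlinarith [sq_nonneg (traceGap Q.mat)]

theorem SO3.transpose_mulVec_dot_self (Q : SO3) (x : Vec) :
    (Q.matᵀ *ᵥ x) ⬝ᵥ (Q.matᵀ *ᵥ x) = x ⬝ᵥ x := by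
  rw [Matrix.dotProduct_mulVec, Matrix.vecMul_transpose, Matrix.mulVec_mulVec, Q.mul_transpose,
    Matrix.one_mulVec]

theorem exists_energy_bounds (P : Params) (Rd : SO3) {lam : Fin 3 → ℝ} (hlam : ∀ i, 0 < lam i) :
    ∃ a > 0, ∃ A > 0, ∀ R ω, a * stateDist Rd R ω ^ 2 ≤ P.energy lam Rd R ω ∧
      P.energy lam Rd R ω ≤ A * stateDist Rd R ω ^ 2 := by
  obtain ⟨i, hi⟩ := Finite.exists_min lam
  obtain ⟨j, hj⟩ := Finite.exists_max lam
  obtain ⟨b, hb, hM⟩ := P.exists_le_dot_inertia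
  obtain ⟨K, hK, hMK⟩ := P.exists_M_mulVec_le
  refine ⟨min (lam i / 2) (b / 2), lt_min (half_pos (hlam i)) (half_pos hb),
    lam j + (1 + K), add_pos (hlam j) (by positivity), fun R ω => ?_⟩
  have hg := traceGap_nonneg (relAtt Rd R)
  have hω := dot_self_nonneg ω
  rw [stateDist_sq, Params.energy]
  constructor
  · have h1 := le_potential hi (relAtt Rd R)
    have h2 := hM (advected R) ω
    rw [← P.M_eq_inertia] at h2
    have h3 := mul_le_mul_of_nonneg_right (min_le_left (lam i / 2) (b / 2)) hg
    have h4 := mul_le_mul_of_nonneg_right (min_le_right (lam i / 2) (b / 2)) hω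
    linarith
  · have h1 := potential_le hj (relAtt Rd R)
    have h2 := two_mul_dot_le ω (P.M R *ᵥ ω) one_pos
    have h3 := hMK R ω
    have h4 := mul_nonneg (hlam j).le hg
    have h5 := mul_nonneg hK.le hg
    have h6 := mul_nonneg (hlam j).le hω
    have h7 := mul_nonneg hK.le hω
    linarith

/-- Along (scaled) closed-loop trajectories, the distance to the equilibrium grows at most by a
constant factor. -/
theorem exists_stateDist_le (P : Params) (Rd : SO3) {lam : Fin 3 → ℝ} (hlam : ∀ i, 0 < lam i)
    {Kv : ℝ} (hKv : 0 ≤ Kv) :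
    ∃ K > 0, ∀ c R ω ν, (∀ t, 0 ≤ c t) →
      IsScaledTrajectory P (fun R ω => dV lam Rd R + Kv • ω) c R ω ν →
      ∀ t, 0 ≤ t → stateDist Rd (R t) (ω t) ≤ K * stateDist Rd (R 0) (ω 0) := by
  obtain ⟨a, ha, A, hA, hE⟩ := exists_energy_bounds P Rd hlam
  refine ⟨Real.sqrt (A / a), Real.sqrt_pos.2 (div_pos hA ha), fun c R ω ν hc h t ht => ?_⟩
  refine (sq_le_sq₀ (stateDist_nonneg _ _ _)
    (mul_nonneg (Real.sqrt_nonneg _) (stateDist_nonneg _ _ _))).1 ?_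
  rw [mul_pow, Real.sq_sqrt (div_pos hA ha).le, div_mul_eq_mul_div, le_div_iff₀ ha, mul_comm]
  exact ((hE _ _).1.trans (h.energy_le hKv hc ht)).trans (hE _ _).2

theorem Params.momentum_dot_self_bound (P : Params) (Rd : SO3) (δ B : ℝ) :
    ∃ N > 0, ∀ R ω ν, stateDist Rd R ω ≤ δ → ‖ν‖ ≤ B →
      P.momentum R ω ν ⬝ᵥ P.momentum R ω ν ≤ N := by
  obtain ⟨K, hK, hMK⟩ := P.exists_M_mulVec_le
  have hJ := P.Ja_pos
  refine ⟨2 * (K * δ ^ 2) + 2 * (P.Ja ^ 2 * (2 * δ ^ 2 + 2 * (3 * B ^ 2))) + 1, by positivity,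
    fun R ω ν hd hν => ?_⟩
  have hω : ω ⬝ᵥ ω ≤ δ ^ 2 := (dot_self_le_stateDist_sq Rd R ω).trans
    (pow_le_pow_left₀ (stateDist_nonneg _ _ _) hd 2)
  have hν2 : ν ⬝ᵥ ν ≤ 3 * B ^ 2 := by
    have h (i) : ν i ^ 2 ≤ B ^ 2 := by
      rw [← sq_abs]
      exact pow_le_pow_left₀ (abs_nonneg _) ((norm_le_pi_norm ν i).trans hν) 2
    rw [dot_three]
    linarith [h 0, h 1, h 2]
  have h1 := dot_self_add_le (P.M R *ᵥ ω) (P.Ja • (ω + ν))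
  have h2 : (P.Ja • (ω + ν)) ⬝ᵥ (P.Ja • (ω + ν)) = P.Ja ^ 2 * ((ω + ν) ⬝ᵥ (ω + ν)) := by
    rw [smul_dotProduct, dotProduct_smul, smul_eq_mul, smul_eq_mul]
    ring
  have h3 : P.Ja ^ 2 * ((ω + ν) ⬝ᵥ (ω + ν)) ≤ P.Ja ^ 2 * (2 * δ ^ 2 + 2 * (3 * B ^ 2)) :=
    mul_le_mul_of_nonneg_left ((dot_self_add_le ω ν).trans (by linarith)) (by positivity)
  have h4 := (hMK R ω).trans (mul_le_mul_of_nonneg_left hω hK.le)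
  rw [Params.momentum]
  linarith

/-- The cross term of the strict Lyapunov function. -/
def Params.crossTerm (P : Params) (Rd R : SO3) (ω : Vec) : ℝ :=
  axial (relAtt Rd R).mat ⬝ᵥ (P.M R *ᵥ ω)

theorem Params.exists_abs_crossTerm_le (P : Params) (Rd : SO3) :
    ∃ K > 0, ∀ R ω, |P.crossTerm Rd R ω| ≤ K * stateDist Rd R ω ^ 2 := by
  obtain ⟨K, hK, hMK⟩ := P.exists_M_mulVec_le
  refine ⟨1 + K, by positivity, fun R ω => ?_⟩
  have h1 := two_mul_dot_le (axial (relAtt Rd R).mat) (P.M R *ᵥ ω) one_pos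
  have h2 := two_mul_dot_le (-axial (relAtt Rd R).mat) (P.M R *ᵥ ω) one_pos
  rw [neg_dotProduct, neg_dotProduct_neg] at h2
  have h3 := hMK R ω
  have h4 := axial_dot_self_le (relAtt Rd R)
  have hg := traceGap_nonneg (relAtt Rd R)
  have hω := dot_self_nonneg ω
  have h5 := mul_nonneg hK.le hg
  have h6 := mul_nonneg hK.le hω
  rw [stateDist_sq, Params.crossTerm, abs_le]
  constructor <;> linarith

/-- Along trajectories that stay within `90°` of the desired attitude and whose momentum is bounded,
the cross term decreases, up to a multiple of `|ω|²`. -/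
theorem exists_hasDerivWithinAt_crossTerm_le (P : Params) (Rd : SO3) {lam : Fin 3 → ℝ}
    (hlam : ∀ i, 0 < lam i) (Kv : ℝ) {N : ℝ} (hN : 0 < N) :
    ∃ l > 0, ∃ K > 0, ∀ R ω ν,
      IsScaledTrajectory P (fun R ω => dV lam Rd R + Kv • ω) (fun _ => 1) R ω ν →
      ∀ t, 0 ≤ t → traceGap (relAtt Rd (R t)).mat ≤ 2 →
      P.momentum (R t) (ω t) (ν t) ⬝ᵥ P.momentum (R t) (ω t) (ν t) ≤ N →
      ∃ d ≤ K * (ω t ⬝ᵥ ω t) - l * traceGap (relAtt Rd (R t)).mat,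
        HasDerivWithinAt (fun s => P.crossTerm Rd (R s) (ω s)) d (Set.Ici 0) t := by
  obtain ⟨i, hi⟩ := Finite.exists_min lam
  obtain ⟨K, hK, hMK⟩ := P.exists_M_mulVec_le
  have hl := hlam i
  refine ⟨lam i / 2, by positivity, (5 + K) / 2 + (2 * lam i)⁻¹ * (N + Kv ^ 2) / 2,
    by positivity, fun R ω ν h t ht hgap hmom => ?_⟩
  set Q := relAtt Rd (R t) with hQ
  set q := P.momentum (R t) (ω t) (ν t) with hq
  set g := traceGap Q.mat with hg
  have hg0 : 0 ≤ g := traceGap_nonneg Q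
  have hω := dot_self_nonneg (ω t)
  set x' : Vec := (1 / 2 : ℝ) • ((3 - g) • ω t + -(Q.matᵀ *ᵥ ω t)) with hx'
  set z : Vec := q ⨯₃ ω t - Kv • ω t with hz
  have hdot := hasDerivWithinAt_dot (x' := x') (y' := z - dV lam Rd (R t))
    (fun i => (h.hasDerivWithinAt_axial Rd ht i).congr_deriv (by
      simp only [hx', Pi.smul_apply, Pi.add_apply, Pi.neg_apply, smul_eq_mul, ← hQ, ← hg]
      ring))
    (fun i => (h.hasDerivWithinAt_M_mulVec ht i).congr_deriv (by
      simp only [hz, Pi.smul_apply, Pi.add_apply, Pi.sub_apply, smul_eq_mul, ← hq]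
      ring))
  refine ⟨_, ?_, hdot⟩
  rw [dV_eq_gradV, ← hQ, dotProduct_sub]
  have e1 : x' ⬝ᵥ x' ≤ 5 * (ω t ⬝ᵥ ω t) := by
    have h1 := dot_self_add_le ((3 - g) • ω t) (-(Q.matᵀ *ᵥ ω t))
    rw [neg_dotProduct_neg, Q.transpose_mulVec_dot_self, smul_dotProduct, dotProduct_smul,
      smul_eq_mul, smul_eq_mul] at h1
    rw [hx', smul_dotProduct, dotProduct_smul, smul_eq_mul, smul_eq_mul]
    have h2 : (3 - g) * (3 - g) ≤ 9 := by nlinarith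
    have h3 := mul_le_mul_of_nonneg_right h2 hω
    linarith
  have e2 := two_mul_dot_le x' (P.M (R t) *ᵥ ω t) one_pos
  have e3 := hMK (R t) (ω t)
  have e4 : z ⬝ᵥ z ≤ (N + Kv ^ 2) * (ω t ⬝ᵥ ω t) := by
    have h1 : z ⬝ᵥ z = (q ⨯₃ ω t) ⬝ᵥ (q ⨯₃ ω t) + Kv ^ 2 * (ω t ⬝ᵥ ω t) := by
      rw [hz]
      simp only [sub_dotProduct, dotProduct_sub, smul_dotProduct, dotProduct_smul, smul_eq_mul,
        dotProduct_comm (q ⨯₃ ω t) (ω t), dot_cross_self]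
      ring
    rw [h1, cross_dot_self]
    nlinarith [sq_nonneg (q ⬝ᵥ ω t), mul_le_mul_of_nonneg_right hmom hω]
  have e5 := two_mul_dot_le (axial Q.mat) z (a := 2 * lam i) (by positivity)
  have e6 := le_axial_dot_gradV hi Q
  have e7 : g / 2 ≤ axial Q.mat ⬝ᵥ axial Q.mat := by
    rw [axial_dot_self, ← hg]
    nlinarith
  have e8 := mul_le_mul_of_nonneg_left e7 hl.le
  have e9 := mul_le_mul_of_nonneg_left e4 (inv_pos.2 (mul_pos two_pos hl)).le
  linarith

theorem exists_exponential_decay (P : Params) (Rd : SO3) {lam : Fin 3 → ℝ}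
    (hlam : ∀ i, 0 < lam i) {Kv : ℝ} (hKv : 0 < Kv) :
    ∃ δ > 0, ∀ B : ℝ, ∃ C > 0, ∃ α > 0, ∀ R ω ν,
      IsTrajectory P (fun R ω => dV lam Rd R + Kv • ω) R ω ν →
      stateDist Rd (R 0) (ω 0) < δ → ‖ν 0‖ ≤ B → ∀ t, 0 ≤ t →
        stateDist Rd (R t) (ω t) ≤ C * stateDist Rd (R 0) (ω 0) * Real.exp (-α * t) := by
  obtain ⟨K, hK, hstab⟩ := exists_stateDist_le P Rd hlam hKv.le
  obtain ⟨a, ha, A, hA, hE⟩ := exists_energy_bounds P Rd hlam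
  obtain ⟨K₁, hK₁, hcross⟩ := P.exists_abs_crossTerm_le Rd
  refine ⟨1 / K, by positivity, fun B => ?_⟩
  obtain ⟨N, hN, hmom⟩ := P.momentum_dot_self_bound Rd (1 / K) B
  obtain ⟨l, hl, K₂, hK₂, hderiv⟩ := exists_hasDerivWithinAt_crossTerm_le P Rd hlam Kv hN
  obtain ⟨ε, hε, hε1, hε2⟩ : ∃ ε > 0, ε * K₁ ≤ a / 2 ∧ ε * K₂ ≤ Kv / 2 := by
    refine ⟨min (a / 2 / K₁) (Kv / 2 / K₂), by positivity, ?_, ?_⟩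
    · exact (le_div_iff₀ hK₁).1 (min_le_left _ _)
    · exact (le_div_iff₀ hK₂).1 (min_le_right _ _)
  obtain ⟨β, hβ, hβ1, hβ2⟩ : ∃ β > 0, 2 * β ≤ ε * l ∧ β ≤ Kv / 2 :=
    ⟨min (ε * l / 2) (Kv / 2), by positivity,
      by linarith [min_le_left (ε * l / 2) (Kv / 2)], min_le_right _ _⟩
  have hA' : 0 < A + a / 2 := by positivity
  refine ⟨Real.sqrt ((A + a / 2) / (a / 2)), by positivity, β / (A + a / 2) / 2, by positivity,
    fun R ω ν hT h0 hν t ht => ?_⟩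
  have hS := isTrajectory_iff_isScaledTrajectory_one.1 hT
  set W : ℝ → ℝ := fun s => P.energy lam Rd (R s) (ω s) + ε * P.crossTerm Rd (R s) (ω s) with hW
  have hWlow (s : ℝ) : a / 2 * stateDist Rd (R s) (ω s) ^ 2 ≤ W s := by
    have h1 := (hE (R s) (ω s)).1
    have h2 := mul_le_mul_of_nonneg_left (abs_le.1 (hcross (R s) (ω s))).1 hε.le
    have h3 := mul_le_mul_of_nonneg_right hε1 (sq_nonneg (stateDist Rd (R s) (ω s)))
    simp only [hW]
    linarith
  have hWup (s : ℝ) : W s ≤ (A + a / 2) * stateDist Rd (R s) (ω s) ^ 2 := by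
    have h1 := (hE (R s) (ω s)).2
    have h2 := mul_le_mul_of_nonneg_left (abs_le.1 (hcross (R s) (ω s))).2 hε.le
    have h3 := mul_le_mul_of_nonneg_right hε1 (sq_nonneg (stateDist Rd (R s) (ω s)))
    simp only [hW]
    linarith
  have hWderiv (s : ℝ) (hs : 0 ≤ s) : ∃ d ≤ -(β / (A + a / 2)) * W s,
      HasDerivWithinAt W d (Set.Ici 0) s := by
    have hgap : traceGap (relAtt Rd (R s)).mat ≤ 2 := by
      have h1 := hstab _ R ω ν (fun _ => zero_le_one) hS s hs
      have h2 : K * stateDist Rd (R 0) (ω 0) ≤ 1 := by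
        rw [lt_div_iff₀ hK] at h0
        linarith
      have h3 := pow_le_one₀ (n := 2) (stateDist_nonneg Rd (R s) (ω s)) (h1.trans h2)
      linarith [traceGap_le_stateDist_sq Rd (R s) (ω s)]
    obtain ⟨d, hd, hd'⟩ := hderiv R ω ν hS s hs hgap
      ((hS.momentum_dot_self_le hs).trans (hmom _ _ _ h0.le hν))
    refine ⟨_, ?_, (hS.hasDerivWithinAt_energy hs).add (hd'.const_mul ε)⟩
    have h1 := mul_le_mul_of_nonneg_left hd hε.le
    have hω := dot_self_nonneg (ω s)
    have h2 := mul_le_mul_of_nonneg_right hε2 hω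
    have h3 := mul_le_mul_of_nonneg_right hβ1 (traceGap_nonneg (relAtt Rd (R s)))
    have h4 := mul_le_mul_of_nonneg_right hβ2 hω
    have h5 : β / (A + a / 2) * W s ≤ β * stateDist Rd (R s) (ω s) ^ 2 := by
      rw [div_mul_eq_mul_div, div_le_iff₀ hA', mul_assoc]
      exact mul_le_mul_of_nonneg_left (by linarith [hWup s]) hβ.le
    rw [stateDist_sq] at h5
    linarith
  choose! W' hW'le hW' using hWderiv
  have hdecay := le_mul_exp_of_hasDerivWithinAt hW' hW'le ht
  refine (sq_le_sq₀ (stateDist_nonneg _ _ _) (mul_nonneg (mul_nonneg (Real.sqrt_nonneg _)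
    (stateDist_nonneg _ _ _)) (Real.exp_pos _).le)).1 ?_
  rw [mul_pow, mul_pow, Real.sq_sqrt (by positivity), ← Real.exp_nat_mul,
    show ((2 : ℕ) : ℝ) * (-(β / (A + a / 2) / 2) * t) = -(β / (A + a / 2)) * t by
      push_cast; ring, div_mul_eq_mul_div, div_mul_eq_mul_div, le_div_iff₀ (by positivity)]
  have h1 := mul_le_mul_of_nonneg_right (hWup 0) (Real.exp_pos (-(β / (A + a / 2)) * t)).le
  linarith [hWlow t]

theorem exists_forall_hasDerivAt_of_lipschitzWith {E : Type*} [NormedAddCommGroup E]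
    [NormedSpace ℝ E] [CompleteSpace E] {v : E → E} {K L : NNReal} (hv : LipschitzWith K v)
    (hL : ∀ x, ‖v x‖ ≤ L) (x₀ : E) :
    ∃ x : ℝ → E, x 0 = x₀ ∧ ∀ t, HasDerivAt x (v (x t)) t := by
  have hloc (n : ℕ) : ∃ x : ℝ → E, x 0 = x₀ ∧
      ∀ t ∈ Set.Icc (-n : ℝ) n, HasDerivWithinAt x (v (x t)) (Set.Icc (-n : ℝ) n) t := by
    have h0 : (0 : ℝ) ∈ Set.Icc (-n : ℝ) n := by simp
    have hPL : IsPicardLindelof (fun _ => v) (⟨0, h0⟩ : Set.Icc (-n : ℝ) n) x₀ (L * n) 0 L K :=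
      { lipschitzOnWith := fun _ _ => hv.lipschitzOnWith
        continuousOn := fun _ _ => continuousOn_const
        norm_le := fun _ _ x _ => hL x
        mul_max_le := by simp }
    obtain ⟨x, hx0, hx⟩ := hPL.exists_eq_forall_mem_Icc_hasDerivWithinAt₀
    exact ⟨x, hx0, hx⟩
  choose x hx0 hx using hloc
  have hxd {n : ℕ} {t : ℝ} (ht : t ∈ Set.Ioo (-n : ℝ) n) : HasDerivAt (x n) (v (x n t)) t :=
    (hx n t (Set.Ioo_subset_Icc_self ht)).hasDerivAt (Icc_mem_nhds ht.1 ht.2)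
  have huniq {m n : ℕ} (hm : 0 < m) (hmn : m ≤ n) :
      Set.EqOn (x m) (x n) (Set.Ioo (-m : ℝ) m) := by
    have hmn' : (m : ℝ) ≤ n := Nat.cast_le.2 hmn
    have hm' : (0 : ℝ) < m := Nat.cast_pos.2 hm
    refine ODE_solution_unique_of_mem_Ioo (v := fun _ => v) (s := fun _ => Set.univ) (K := K)
      (t₀ := 0) (fun _ _ => hv.lipschitzOnWith) ⟨by linarith, hm'⟩
      (fun t ht => ⟨hxd ht, trivial⟩)
      (fun t ht => ⟨hxd ⟨by linarith [ht.1], by linarith [ht.2]⟩, trivial⟩) ?_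
    rw [hx0, hx0]
  refine ⟨fun t => x (⌈|t|⌉₊ + 1) t, hx0 _, fun t => ?_⟩
  have hmem (s : ℝ) : s ∈ Set.Ioo (-(⌈|s|⌉₊ + 1 : ℕ) : ℝ) (⌈|s|⌉₊ + 1 : ℕ) := by
    have h := Nat.le_ceil |s|
    rw [Set.mem_Ioo, ← abs_lt]
    push_cast
    linarith
  refine (hxd (hmem t)).congr_of_eventuallyEq ?_
  filter_upwards [Ioo_mem_nhds (hmem t).1 (hmem t).2] with s hs
  rcases le_total (⌈|s|⌉₊ + 1) (⌈|t|⌉₊ + 1) with h | h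
  · exact huniq (Nat.succ_pos _) h (hmem s)
  · exact (huniq (Nat.succ_pos _) h hs).symm

/-- The unconstrained state space of `(R, ω, Θ̇)`. -/
abbrev State : Type := (Fin 3 → Fin 3 → ℝ) × Vec × Vec

/-- The feedback as a function on the unconstrained state space. -/
def stateFeedback (lam : Fin 3 → ℝ) (Rd : SO3) (Kv : ℝ) (x : State) : Vec :=
  gradV lam (Rd.matᵀ * Matrix.of x.1) + Kv • x.2.1

/-- The angular acceleration as a function on the unconstrained state space. -/
def Params.stateOmegaDot (P : Params) (lam : Fin 3 → ℝ) (Rd : SO3) (Kv : ℝ) (x : State) : Vec :=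
  (P.inertia (x.1 2))⁻¹ *ᵥ ((P.Imat *ᵥ x.2.1 + P.Jmat *ᵥ x.2.2) ⨯₃ x.2.1
    - stateFeedback lam Rd Kv x)

/-- The closed-loop vector field on the unconstrained state space. -/
def Params.stateField (P : Params) (lam : Fin 3 → ℝ) (Rd : SO3) (Kv : ℝ) (x : State) : State :=
  (Matrix.of x.1 * hat x.2.1, P.stateOmegaDot lam Rd Kv x,
    P.Jmat⁻¹ *ᵥ stateFeedback lam Rd Kv x - P.stateOmegaDot lam Rd Kv x)

theorem Params.contDiff_inertia (P : Params) (i j : Fin 3) :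
    ContDiff ℝ 1 fun G : Vec => P.inertia G i j := by
  fin_cases i <;> fin_cases j <;>
    simp [Params.inertia, Params.Imat, hat, Matrix.mul_apply, Fin.sum_univ_three] <;>
    fun_prop

theorem Params.contDiff_inertia_inv (P : Params) (i j : Fin 3) :
    ContDiff ℝ 1 fun G : Vec => (P.inertia G)⁻¹ i j := by
  have h := P.contDiff_inertia
  have hdet : ContDiff ℝ 1 fun G : Vec => (P.inertia G).det := by
    simp only [Matrix.det_fin_three]
    fun_prop
  have hadj : ContDiff ℝ 1 fun G : Vec => (P.inertia G).adjugate i j := by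
    simp only [Matrix.adjugate_fin_three]
    fin_cases i <;> fin_cases j <;> simp <;> fun_prop
  have hinv (G : Vec) : (P.inertia G)⁻¹ i j = (P.inertia G).det⁻¹ * (P.inertia G).adjugate i j := by
    rw [Matrix.inv_def, Ring.inverse_eq_inv']
    rfl
  simp only [hinv]
  exact (hdet.inv fun G => (P.isUnit_det_inertia G).ne_zero).mul hadj

theorem contDiff_stateFeedback (lam : Fin 3 → ℝ) (Rd : SO3) (Kv : ℝ) :
    ContDiff ℝ 1 (stateFeedback lam Rd Kv) := by
  refine contDiff_pi.2 fun i => ?_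
  fin_cases i <;>
    simp [stateFeedback, gradV, Matrix.mul_apply, Fin.sum_univ_three] <;> fun_prop

theorem Params.contDiff_stateOmegaDot (P : Params) (lam : Fin 3 → ℝ) (Rd : SO3) (Kv : ℝ) :
    ContDiff ℝ 1 (P.stateOmegaDot lam Rd Kv) := by
  have hu := contDiff_pi.1 (contDiff_stateFeedback lam Rd Kv)
  have hz (j : Fin 3) : ContDiff ℝ 1 fun x : State =>
      ((P.Imat *ᵥ x.2.1 + P.Jmat *ᵥ x.2.2) ⨯₃ x.2.1 - stateFeedback lam Rd Kv x) j := by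
    refine ContDiff.sub ?_ (hu j)
    simp only [cross_apply, Pi.add_apply, P.Imat_mulVec, P.Jmat_mulVec, Pi.smul_apply, smul_eq_mul]
    fin_cases j <;> simp <;> fun_prop
  have hM (i j : Fin 3) : ContDiff ℝ 1 fun x : State => (P.inertia (x.1 2))⁻¹ i j :=
    (P.contDiff_inertia_inv i j).comp (by fun_prop)
  refine contDiff_pi.2 fun i => ?_
  simp only [Params.stateOmegaDot, Matrix.mulVec, dotProduct]
  exact ContDiff.sum fun j _ => (hM i j).mul (hz j)

theorem Params.contDiff_stateField (P : Params) (lam : Fin 3 → ℝ) (Rd : SO3) (Kv : ℝ) :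
    ContDiff ℝ 1 (P.stateField lam Rd Kv) := by
  have hw := P.contDiff_stateOmegaDot lam Rd Kv
  refine ContDiff.prodMk ?_ (hw.prodMk ?_)
  · refine contDiff_pi.2 fun i => contDiff_pi.2 fun j => ?_
    fin_cases j <;> simp [Matrix.mul_apply, Fin.sum_univ_three, hat] <;> fun_prop
  · simp only [P.Jmat_inv_mulVec]
    exact ((contDiff_stateFeedback lam Rd Kv).const_smul _).sub hw

theorem Params.stateField_eq (P : Params) (lam : Fin 3 → ℝ) (Rd : SO3) (Kv : ℝ) (R : SO3)
    (ω ν : Vec) : P.stateField lam Rd Kv (R.mat, ω, ν)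
      = (R.mat * hat ω, P.omegaDot R ω ν (dV lam Rd R + Kv • ω),
        P.rotorDot R ω ν (dV lam Rd R + Kv • ω)) := by
  have hu : stateFeedback lam Rd Kv (R.mat, ω, ν) = dV lam Rd R + Kv • ω := by
    rw [dV_eq_gradV, relAtt_mat]
    rfl
  have hG : advected R = R.mat 2 := funext fun i => advected_apply R i
  have hw : P.stateOmegaDot lam Rd Kv (R.mat, ω, ν)
      = P.omegaDot R ω ν (dV lam Rd R + Kv • ω) := by
    rw [Params.stateOmegaDot, hu, Params.omegaDot, P.M_eq_inertia, hG, Matrix.mulVec_sub]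
  rw [Params.stateField, hu, hw]
  rfl

/-- Flows of left-invariant type preserve the rotation group. -/
theorem mem_specialOrthogonalGroup_of_hasDerivAt {A : ℝ → Matrix (Fin 3) (Fin 3) ℝ} {c : ℝ → ℝ}
    {ω : ℝ → Vec} (hA : ∀ t i j, HasDerivAt (fun s => A s i j) (c t * (A t * hat (ω t)) i j) t)
    (h0 : A 0 ∈ Matrix.specialOrthogonalGroup (Fin 3) ℝ) (t : ℝ) :
    A t ∈ Matrix.specialOrthogonalGroup (Fin 3) ℝ := by
  have hconst {f : ℝ → ℝ} (hf : ∀ t, HasDerivAt f 0 t) : f t = f 0 :=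
    is_const_of_deriv_eq_zero (fun s => (hf s).differentiableAt) (fun s => (hf s).deriv) t 0
  have hdet : (A t).det = (A 0).det := by
    refine hconst (f := fun s => (A s).det) fun s => ?_
    simp only [Matrix.det_fin_three]
    have h := hA s
    refine ((((((((h 0 0).mul (h 1 1)).mul (h 2 2)).sub (((h 0 0).mul (h 1 2)).mul (h 2 1))).sub
      (((h 0 1).mul (h 1 0)).mul (h 2 2))).add (((h 0 1).mul (h 1 2)).mul (h 2 0))).add
      (((h 0 2).mul (h 1 0)).mul (h 2 1))).sub (((h 0 2).mul (h 1 1)).mul (h 2 0))).congr_deriv ?_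
    simp [Matrix.mul_apply, Fin.sum_univ_three, hat]
    ring
  have hmul : A t * (A t)ᵀ = A 0 * (A 0)ᵀ := by
    ext i j
    simp only [Matrix.mul_apply, Fin.sum_univ_three, Matrix.transpose_apply]
    refine hconst (f := fun s => A s i 0 * A s j 0 + A s i 1 * A s j 1 + A s i 2 * A s j 2)
      fun s => ?_
    have h := hA s
    refine ((((h i 0).mul (h j 0)).add ((h i 1).mul (h j 1))).add
      ((h i 2).mul (h j 2))).congr_deriv ?_
    simp [Matrix.mul_apply, Fin.sum_univ_three, hat]
    ring
  rw [Matrix.mem_specialOrthogonalGroup_iff, Matrix.mem_orthogonalGroup_iff] at h0 ⊢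
  exact ⟨hmul.trans h0.1, hdet.trans h0.2⟩

theorem SO3.abs_apply_le_one (R : SO3) (i j : Fin 3) : |R.mat i j| ≤ 1 := by
  have h : R.mat i j ^ 2 ≤ (R.mat i) ⬝ᵥ (R.mat i) := sq_coord_le_dot_self _ j
  have h1 := R.row_dot i
  rw [dot_three] at h
  exact abs_le_one_iff_mul_self_le_one.2 (by linarith)

theorem norm_le_sqrt_dot_self (x : Vec) : ‖x‖ ≤ Real.sqrt (x ⬝ᵥ x) :=
  (pi_norm_le_iff_of_nonneg (Real.sqrt_nonneg _)).2 fun i =>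
    Real.abs_le_sqrt (sq_coord_le_dot_self x i)

/-- Scaled closed-loop trajectories are bounded, uniformly in the scaling. -/
theorem exists_scaledTrajectory_norm_le (P : Params) (Rd : SO3) {lam : Fin 3 → ℝ}
    (hlam : ∀ i, 0 < lam i) {Kv : ℝ} (hKv : 0 ≤ Kv) (R₀ : SO3) (ω₀ ν₀ : Vec) :
    ∃ ρ > 0, ∀ c R ω ν, (∀ t, 0 ≤ c t) →
      IsScaledTrajectory P (fun R ω => dV lam Rd R + Kv • ω) c R ω ν →
      R 0 = R₀ → ω 0 = ω₀ → ν 0 = ν₀ →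
      ∀ t, 0 ≤ t → ‖(((R t).mat, ω t, ν t) : State)‖ ≤ ρ := by
  obtain ⟨K, hK, hstab⟩ := exists_stateDist_le P Rd hlam hKv
  obtain ⟨K₁, hK₁, hM⟩ := P.exists_M_mulVec_le
  have hJ := P.Ja_pos
  set b := (K * stateDist Rd R₀ ω₀) ^ 2 with hb
  set m := P.momentum R₀ ω₀ ν₀ ⬝ᵥ P.momentum R₀ ω₀ ν₀ with hm
  set b' := (2 * m + 2 * (2 * (K₁ * b) + 2 * (P.Ja ^ 2 * b))) / P.Ja ^ 2 with hb'
  refine ⟨1 + Real.sqrt b + Real.sqrt b', by positivity, ?_⟩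
  rintro c R ω ν hc h rfl rfl rfl t ht
  have hω : ω t ⬝ᵥ ω t ≤ b :=
    (dot_self_le_stateDist_sq Rd (R t) (ω t)).trans
      (pow_le_pow_left₀ (stateDist_nonneg _ _ _) (hstab c R ω ν hc h t ht) 2)
  have hν : ν t ⬝ᵥ ν t ≤ b' := by
    rw [hb', le_div_iff₀ (by positivity)]
    have h1 : P.Ja • ν t = P.momentum (R t) (ω t) (ν t)
        + -(P.M (R t) *ᵥ ω t + P.Ja • ω t) := by
      rw [Params.momentum, smul_add]
      abel
    have h2 : (P.Ja • ν t) ⬝ᵥ (P.Ja • ν t) = (ν t ⬝ᵥ ν t) * P.Ja ^ 2 := by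
      rw [smul_dotProduct, dotProduct_smul, smul_eq_mul, smul_eq_mul]
      ring
    have h3 : (P.Ja • ω t) ⬝ᵥ (P.Ja • ω t) = P.Ja ^ 2 * (ω t ⬝ᵥ ω t) := by
      rw [smul_dotProduct, dotProduct_smul, smul_eq_mul, smul_eq_mul]
      ring
    have h4 := dot_self_add_le (P.momentum (R t) (ω t) (ν t))
      (-(P.M (R t) *ᵥ ω t + P.Ja • ω t))
    rw [← h1, h2, neg_dotProduct_neg] at h4
    have h5 := dot_self_add_le (P.M (R t) *ᵥ ω t) (P.Ja • ω t)
    rw [h3] at h5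
    have h6 := hM (R t) (ω t)
    have h7 := h.momentum_dot_self_le ht
    have h8 := mul_le_mul_of_nonneg_left hω hK₁.le
    have h9 := mul_le_mul_of_nonneg_left hω (sq_nonneg P.Ja)
    linarith
  have hR : ‖(id (R t).mat : Fin 3 → Fin 3 → ℝ)‖ ≤ 1 :=
    (pi_norm_le_iff_of_nonneg zero_le_one).2 fun i =>
      (pi_norm_le_iff_of_nonneg zero_le_one).2 fun j => (R t).abs_apply_le_one i j
  have hω' := (norm_le_sqrt_dot_self (ω t)).trans (Real.sqrt_le_sqrt hω)
  have hν' := (norm_le_sqrt_dot_self (ν t)).trans (Real.sqrt_le_sqrt hν)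
  have n1 := Real.sqrt_nonneg b
  have n2 := Real.sqrt_nonneg b'
  refine norm_prod_le_iff.2 ⟨hR.trans (by linarith),
    norm_prod_le_iff.2 ⟨hω'.trans (by linarith), hν'.trans (by linarith)⟩⟩

/-- Global forward existence for the closed-loop system. -/
theorem exists_isTrajectory (P : Params) (Rd : SO3) {lam : Fin 3 → ℝ}
    (hlam : ∀ i, 0 < lam i) {Kv : ℝ} (hKv : 0 ≤ Kv) (R₀ : SO3) (ω₀ ν₀ : Vec) :
    ∃ R ω ν, IsTrajectory P (fun R ω => dV lam Rd R + Kv • ω) R ω ν ∧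
      R 0 = R₀ ∧ ω 0 = ω₀ ∧ ν 0 = ν₀ := by
  obtain ⟨ρ, hρ, hbound⟩ := exists_scaledTrajectory_norm_le P Rd hlam hKv R₀ ω₀ ν₀
  let χ : ContDiffBump (0 : State) := ⟨ρ, ρ + 1, hρ, by linarith⟩
  let v : State → State := fun x => χ x • P.stateField lam Rd Kv x
  have hv : ContDiff ℝ 1 v := χ.contDiff.smul (P.contDiff_stateField lam Rd Kv)
  have hsupp : HasCompactSupport v := χ.hasCompactSupport.smul_right
  obtain ⟨K, hK⟩ := hv.lipschitzWith_of_hasCompactSupport hsupp one_ne_zero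
  obtain ⟨L, hL⟩ := hsupp.exists_bound_of_continuous hv.continuous
  obtain ⟨x, hx0, hx⟩ := exists_forall_hasDerivAt_of_lipschitzWith (L := L.toNNReal) hK
    (fun y => (hL y).trans (Real.le_coe_toNNReal L)) (R₀.mat, ω₀, ν₀)
  have hx1 (t : ℝ) (i j : Fin 3) : HasDerivAt (fun s => (x s).1 i j)
      (χ (x t) * (Matrix.of (x t).1 * hat (x t).2.1) i j) t :=
    hasDerivAt_pi.1 (hasDerivAt_pi.1 (hx t).fst i) j
  have hx2 (t : ℝ) (i : Fin 3) : HasDerivAt (fun s => (x s).2.1 i)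
      (χ (x t) * (P.stateField lam Rd Kv (x t)).2.1 i) t :=
    hasDerivAt_pi.1 (hx t).snd.fst i
  have hx3 (t : ℝ) (i : Fin 3) : HasDerivAt (fun s => (x s).2.2 i)
      (χ (x t) * (P.stateField lam Rd Kv (x t)).2.2 i) t :=
    hasDerivAt_pi.1 (hx t).snd.snd i
  have hmem := mem_specialOrthogonalGroup_of_hasDerivAt (A := fun t => Matrix.of (x t).1)
    (c := fun t => χ (x t)) (ω := fun t => (x t).2.1) hx1 (by
      simp only [hx0]
      exact R₀.2)
  let R : ℝ → SO3 := fun t => ⟨Matrix.of (x t).1, hmem t⟩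
  have hS : IsScaledTrajectory P (fun R ω => dV lam Rd R + Kv • ω) (fun t => χ (x t)) R
      (fun t => (x t).2.1) (fun t => (x t).2.2) := by
    have hfield (t : ℝ) : P.stateField lam Rd Kv (x t) = _ :=
      P.stateField_eq lam Rd Kv (R t) (x t).2.1 (x t).2.2
    refine ⟨fun t _ i j => (hx1 t i j).hasDerivWithinAt, fun t _ i => ?_, fun t _ i => ?_⟩
    · have h := hx2 t i
      rw [hfield] at h
      exact h.hasDerivWithinAt
    · have h := hx3 t i
      rw [hfield] at h
      exact h.hasDerivWithinAt
  have hR0 : R 0 = R₀ := Subtype.ext (congrArg Prod.fst hx0)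
  have hω0 : (x 0).2.1 = ω₀ := by rw [hx0]
  have hν0 : (x 0).2.2 = ν₀ := by rw [hx0]
  have hone (t : ℝ) (ht : 0 ≤ t) : χ (x t) = 1 := by
    refine χ.one_of_mem_closedBall (mem_closedBall_zero_iff.2 ?_)
    exact hbound _ R _ _ (fun _ => χ.nonneg) hS hR0 hω0 hν0 t ht
  refine ⟨R, fun t => (x t).2.1, fun t => (x t).2.2,
    isTrajectory_iff_isScaledTrajectory_one.2 ⟨fun t ht i j => ?_, fun t ht i => ?_, fun t ht i => ?_⟩, hR0, hω0, hν0⟩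
  · simpa only [hone t ht] using hS.attitude t ht i j
  · simpa only [hone t ht] using hS.velocity t ht i
  · simpa only [hone t ht] using hS.rotor t ht i

theorem tendsto_of_tendsto_stateDist {Rd : SO3} {R : ℝ → SO3} {ω : ℝ → Vec} {l : Filter ℝ}
    (h : Filter.Tendsto (fun t => stateDist Rd (R t) (ω t)) l (nhds 0)) :
    Filter.Tendsto R l (nhds Rd) ∧ Filter.Tendsto ω l (nhds 0) := by
  have hsq (t : ℝ) : stateDist Rd (R t) (ω t) ^ 2
      = (∑ i, ∑ j, ((R t).mat j i - Rd.mat j i) ^ 2) + ∑ i, ω t i ^ 2 := by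
    have h1 : 0 ≤ (∑ i, ∑ j, ((R t).mat j i - Rd.mat j i) ^ 2) + ∑ i, ω t i ^ 2 := by positivity
    have h2 : Matrix.trace (((R t).mat - Rd.mat)ᵀ * ((R t).mat - Rd.mat)) + ω t ⬝ᵥ ω t
        = (∑ i, ∑ j, ((R t).mat j i - Rd.mat j i) ^ 2) + ∑ i, ω t i ^ 2 := by
      simp only [Matrix.trace, Matrix.diag_apply, Matrix.mul_apply, Matrix.transpose_apply,
        Matrix.sub_apply, dotProduct, sq]
    rw [stateDist, h2, Real.sq_sqrt h1]
  have hentry (t : ℝ) (i j : Fin 3) :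
      ((R t).mat i j - Rd.mat i j) ^ 2 ≤ stateDist Rd (R t) (ω t) ^ 2 := by
    rw [hsq]
    calc ((R t).mat i j - Rd.mat i j) ^ 2 ≤ ∑ i, ((R t).mat i j - Rd.mat i j) ^ 2 :=
          Finset.single_le_sum (f := fun i => ((R t).mat i j - Rd.mat i j) ^ 2)
            (fun i _ => sq_nonneg _) (Finset.mem_univ i)
      _ ≤ ∑ j, ∑ i, ((R t).mat i j - Rd.mat i j) ^ 2 :=
          Finset.single_le_sum (f := fun j => ∑ i, ((R t).mat i j - Rd.mat i j) ^ 2)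
            (fun j _ => Finset.sum_nonneg fun i _ => sq_nonneg _) (Finset.mem_univ j)
      _ ≤ _ := le_add_of_nonneg_right (Finset.sum_nonneg fun i _ => sq_nonneg _)
  have hlim {f : ℝ → ℝ} (hf : ∀ t, f t ^ 2 ≤ stateDist Rd (R t) (ω t) ^ 2) :
      Filter.Tendsto f l (nhds 0) :=
    squeeze_zero_norm (fun t => abs_le_of_sq_le_sq (hf t) (stateDist_nonneg _ _ _)) h
  constructor
  · rw [tendsto_subtype_rng]
    refine tendsto_pi_nhds.2 fun i => tendsto_pi_nhds.2 fun j => ?_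
    exact tendsto_sub_nhds_zero_iff.1 (hlim fun t => hentry t i j)
  · refine tendsto_pi_nhds.2 fun i => hlim fun t => ?_
    exact (sq_coord_le_dot_self (ω t) i).trans (dot_self_le_stateDist_sq Rd (R t) (ω t))

theorem isLyapunovStable (P : Params) (Rd : SO3) {lam : Fin 3 → ℝ} (hlam : ∀ i, 0 < lam i)
    {Kv : ℝ} (hKv : 0 ≤ Kv) : IsLyapunovStable P (fun R ω => dV lam Rd R + Kv • ω) Rd := by
  obtain ⟨K, hK, hstab⟩ := exists_stateDist_le P Rd hlam hKv
  refine fun ε hε => ⟨ε / K, div_pos hε hK, fun R₀ ω₀ ν₀ hd =>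
    ⟨exists_isTrajectory P Rd hlam hKv R₀ ω₀ ν₀, ?_⟩⟩
  rintro R ω ν hT rfl rfl rfl t ht
  refine (hstab _ R ω ν (fun _ => zero_le_one)
    (isTrajectory_iff_isScaledTrajectory_one.1 hT) t ht).trans_lt ?_
  rw [lt_div_iff₀ hK] at hd
  linarith

theorem isLocallyAttractive (P : Params) (Rd : SO3) {lam : Fin 3 → ℝ} (hlam : ∀ i, 0 < lam i)
    {Kv : ℝ} (hKv : 0 < Kv) : IsLocallyAttractive P (fun R ω => dV lam Rd R + Kv • ω) Rd := by
  obtain ⟨δ, hδ, hexp⟩ := exists_exponential_decay P Rd hlam hKv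
  refine ⟨δ, hδ, fun R ω ν hT h0 => ?_⟩
  obtain ⟨C, -, α, hα, hle⟩ := hexp ‖ν 0‖
  refine tendsto_of_tendsto_stateDist (squeeze_zero' (.of_forall fun t => stateDist_nonneg _ _ _)
    ((Filter.eventually_ge_atTop 0).mono fun t ht => hle R ω ν hT h0 le_rfl t ht) ?_)
  have h1 : Filter.Tendsto (fun t => Real.exp (-α * t)) Filter.atTop (nhds 0) :=
    Real.tendsto_exp_atBot.comp (Filter.tendsto_id.const_mul_atTop_of_neg (neg_lt_zero.2 hα))
  simpa using h1.const_mul (C * stateDist Rd (R 0) (ω 0))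

theorem Params.feedforward_zero (P : Params) (Rd R : SO3) (ω : Vec) :
    P.feedforward Rd R ω 0 0 = 0 := by
  simp [Params.feedforward]

end SphericalRobot

end

theorem mainTheorem3 (P : SphericalRobot.Params) (Rd : SphericalRobot.SO3)
    (lam : Fin 3 → ℝ) (hlam : ∀ i, 0 < lam i) (Kv : ℝ) (hKv : 0 < Kv) :
    (∀ R ω, P.feedforward Rd R ω 0 0 = 0) ∧
    SphericalRobot.IsLocallyAsymptoticallyStable P
      (fun R ω => SphericalRobot.dV lam Rd R + Kv • ω) Rd ∧
    SphericalRobot.IsLocallyExponentiallyStable P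
      (fun R ω => SphericalRobot.dV lam Rd R + Kv • ω) Rd :=
  ⟨P.feedforward_zero Rd,
    ⟨SphericalRobot.isLyapunovStable P Rd hlam hKv.le,
      SphericalRobot.isLocallyAttractive P Rd hlam hKv⟩,
    SphericalRobot.isLyapunovStable P Rd hlam hKv.le,
    SphericalRobot.exists_exponential_decay P Rd hlam hKv⟩
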